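/- **Theorem 3.4.** Let $p\ge 0$ be an integer and let $\chi_0,\dots,\chi_p$ be any basis of the real polynomials of degree at most $p$ on $[-1,1]$. Let $\mathbf D$ be the matrix of $d/d\xi$ in this basis ($\chi_j'=\sum_i \mathbf D_{ij}\chi_i$), and put $\mathbf M_{mn}=\int_{-1}^1\chi_m\chi_n\,d\xi$, $\mathbf l_j=\chi_j(-1)$, $\mathbf r_j=\chi_j(1)$. For $c\in\mathbb R$ let $\mathbf K=\tfrac12 c\,(\mathbf D^p)^T\mathbf M\mathbf D^p$. The von Neumann matrix of the ESFR scheme with parameter $c$ for the advection equation $u_t+u_x=0$ with upwind flux is $$\mathbf H(\theta)=-2i\left(\mathbf D+(\mathbf M+\mathbf K)^{-1}\mathbf l\mathbf l^T-(\mathbf M+\mathbf K)^{-1}\mathbf l\mathbf r^Te^{-i\theta}\right),\qquad \theta\in\mathbb R.$$ Assume $c_-<c<\infty$, where $$c_-=-\frac{2}{(2p+1)(a_p\,p!)^2},\qquad a_p=\frac{(2p)!}{2^p(p!)^2}.$$ Then there is a function $\omega^h:\mathbb R\to\mathbb C$ such that $\omega^h(\theta)$ is an eigenvalue of $\mathbf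 H(\theta)$ for every $\theta$ and $\omega^h(\theta)-\theta\to0$ as $\theta\to0$ (with value $0$ at $\theta=0$), and any two such functions agree for all sufficiently small $|\theta|$. Put $E_T(\theta)=|\omega^h(\theta)-\theta|$ and $$f(c)=\frac{1}{1+c\,\frac{(2p+1)((2p)!)^2}{2^{2p+1}(p!)^2}},\quad b_1(p,c)=\frac{(1-f(c))\,p!}{(2p)!},\quad b_2(p,c)=\frac{(f(c)-1)\,p!}{2\,(2p)!}+\frac{(p+1)!}{(2p+2)!},$$ $$F(p,c,\theta)=\left|b_1(p,c)(i\theta)^{2p+1}+b_2(p,c)(i\theta)^{2p+2}\right|.$$ There are constants $C_1,C_2>0$, depending only on $p$ and $c$, such that for every such basis and every such $\omega^h$, for all real $\theta$ with $|\theta|$ sufficiently small, $$C_1F(p,c,\theta)\le E_T(\theta)\le C_2F(p,c,\theta).$$ Consequently, as $\theta\to0$, $E_T(\theta)$ is of exact order $|\theta|^{2p+1}$ if $c\ne0$, and of exact order $|\theta|^{2p+2}$ if $c=0$ (the discontinuous Galerkin scheme). -/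

import Mathlib

open Filter Topology Asymptotics

noncomputable section

namespace ESFR

/-- The derivative as a linear operator on the real polynomials of degree at most `p`. -/
def derivOp (p : ℕ) :
    Polynomial.degreeLT ℝ (p + 1) →ₗ[ℝ] Polynomial.degreeLT ℝ (p + 1) :=
  (Polynomial.derivative (R := ℝ)).restrict (fun f hf => by
    rw [Polynomial.mem_degreeLT] at hf ⊢
    exact lt_of_le_of_lt (Polynomial.degree_derivative_le) hf)

/-- A basis of the local approximation space (polynomials of degree at most `p`). -/
abbrev PolyBasis (p : ℕ) : Type :=
  Module.Basis (Fin (p + 1)) ℝ (Polynomial.degreeLT ℝ (p + 1))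

variable {p : ℕ}

/-- The value at `ξ` of the `j`-th basis polynomial. -/
def basisEval (χ : PolyBasis p) (j : Fin (p + 1)) (ξ : ℝ) : ℝ :=
  Polynomial.eval ξ (χ j : Polynomial ℝ)

/-- The differentiation matrix `D`, given by `χ_j' = ∑ i, D i j * χ_i`. -/
def diffMatrix (χ : PolyBasis p) : Matrix (Fin (p + 1)) (Fin (p + 1)) ℝ :=
  LinearMap.toMatrix χ χ (derivOp p)

/-- The mass matrix `M` on the reference element `[-1, 1]`. -/
def massMatrix (χ : PolyBasis p) : Matrix (Fin (p + 1)) (Fin (p + 1)) ℝ :=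
  Matrix.of fun m n => ∫ ξ in (-1 : ℝ)..1, basisEval χ m ξ * basisEval χ n ξ

/-- The filtering matrix `K = (c / 2) (D ^ p)ᵀ M D ^ p`. -/
def filterMatrix (χ : PolyBasis p) (c : ℝ) : Matrix (Fin (p + 1)) (Fin (p + 1)) ℝ :=
  (c / 2) • ((diffMatrix χ ^ p).transpose * massMatrix χ * diffMatrix χ ^ p)

/-- Values of the basis at the left end point of the reference element. -/
def leftVec (χ : PolyBasis p) : Fin (p + 1) → ℝ := fun j => basisEval χ j (-1)

/-- Values of the basis at the right end point of the reference element. -/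
def rightVec (χ : PolyBasis p) : Fin (p + 1) → ℝ := fun j => basisEval χ j 1

/-- The column `(M + K)⁻¹ l`. (It equals `-h_L`, where `h_L` holds the coefficients of the
derivative of the left correction function.) -/
def corrVec (χ : PolyBasis p) (c : ℝ) : Fin (p + 1) → ℝ :=
  Matrix.mulVec (massMatrix χ + filterMatrix χ c)⁻¹ (leftVec χ)

/-- The von Neumann matrix for the upwind flux,
`H(θ) = -2i (D + (M + K)⁻¹ l lᵀ - (M + K)⁻¹ l rᵀ exp (-iθ))`. -/
def vonNeumann (χ : PolyBasis p) (c θ : ℝ) : Matrix (Fin (p + 1)) (Fin (p + 1)) ℂ :=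
  (-2 * Complex.I) •
    ((diffMatrix χ).map Complex.ofReal
      + (Matrix.vecMulVec (corrVec χ c) (leftVec χ)).map Complex.ofReal
      - Complex.exp (-(Complex.I * θ)) •
          (Matrix.vecMulVec (corrVec χ c) (rightVec χ)).map Complex.ofReal)

/-- `ω` is a numerical dispersion-dissipation relation of the scheme: `ω θ` is an eigenvalue of
the von Neumann matrix for every `θ`, and it approximates the exact relation `θ ↦ θ`
as `θ → 0`. -/
def IsPhysical (χ : PolyBasis p) (c : ℝ) (ω : ℝ → ℂ) : Prop :=
  (∀ θ : ℝ, Module.End.HasEigenvalue (Matrix.toLin' (vonNeumann χ c θ)) (ω θ)) ∧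
    Tendsto (fun θ : ℝ => ω θ - (θ : ℂ)) (𝓝 0) (𝓝 0)

/-- The dispersion-dissipation error of the relation `ω`; the exact relation is `θ ↦ θ`. -/
def errT (ω : ℝ → ℂ) (θ : ℝ) : ℝ := ‖ω θ - (θ : ℂ)‖

/-- The lower stability bound `c₋ = -2 / ((2p + 1) (a_p p!)²)` of the ESFR parameter, where
`a_p = (2p)! / (2 ^ p (p!)²)` is the leading coefficient of the Legendre polynomial of
degree `p`. -/
def cMinus (p : ℕ) : ℝ :=
  -2 / ((2 * p + 1) *
    (((2 * p).factorial : ℝ) / (2 ^ p * (p.factorial : ℝ) ^ 2) * (p.factorial : ℝ)) ^ 2)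

/-- `f(c) = 1 / (1 + c (2p + 1) ((2p)!)² / (2 ^ (2p + 1) (p!)²))`. -/
def fPar (p : ℕ) (c : ℝ) : ℝ :=
  1 / (1 + c * (((2 * p + 1) * ((2 * p).factorial : ℝ) ^ 2) /
    (2 ^ (2 * p + 1) * (p.factorial : ℝ) ^ 2)))

/-- The coefficient `b₁(p, c)`. -/
def b1 (p : ℕ) (c : ℝ) : ℝ :=
  (1 - fPar p c) * (p.factorial : ℝ) / ((2 * p).factorial : ℝ)

/-- The coefficient `b₂(p, c)`. -/
def b2 (p : ℕ) (c : ℝ) : ℝ :=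
  (fPar p c - 1) * (p.factorial : ℝ) / (2 * ((2 * p).factorial : ℝ))
    + ((p + 1).factorial : ℝ) / ((2 * p + 2).factorial : ℝ)

/-- `F(p, c, θ) = |b₁ (iθ) ^ (2p + 1) + b₂ (iθ) ^ (2p + 2)|`. -/
def bigF (p : ℕ) (c θ : ℝ) : ℝ :=
  ‖(b1 p c : ℂ) * (Complex.I * θ) ^ (2 * p + 1) + (b2 p c : ℂ) * (Complex.I * θ) ^ (2 * p + 2)‖

end ESFR

end

namespace ESFR

open Polynomial

/-! Put `μ = iω/2`, `z = exp (-iθ)`, and let `g` be the polynomial with coordinates `(M + K)⁻¹ l`.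
The eigenvalue equation reads `D x + φ x • g = μ • x`, where `φ x` is the value of `x` at `-1` minus
`z` times its value at `1`. Since `D` is nilpotent, this reduces to one scalar equation `charFun p g
z μ = 0`, monic of degree `p + 1` in `μ`.

On the exact relation `z = exp (-2μ)`, integration by parts turns `charFun` into `μ ^ (p + 1) * (1 -
∫ g(x) exp (-μ(x + 1)) dx)` (`charFun_exp_eq`). By construction `g` represents evaluation at `-1`
for the form `∫ f h + c f⁽ᵖ⁾ h⁽ᵖ⁾`. Its moments against `(x + 1) ^ m`, `m ≤ p`, are therefore those
of a point mass at `-1`, except for a term proportional to `c` at `m = p`. So the bracket has exact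
order `μ ^ p` if `c ≠ 0` and `μ ^ (p + 1)` if `c = 0`; positivity of the weight `x + 1` makes the
leading coefficients nonzero. This is `IsCorrection.defect_isTheta`, and `F` has the same order
(`bigF_isTheta`).

Finally `μ = 0` is a simple zero of `charFun p g 1` (`IsCorrection.charQuot_ne_zero`), so the error
of the branch through it is comparable to the defect. The polynomial `g` does not depend on the
basis, hence neither do the constants. -/

/-! ### Integration of polynomials over `[-1, 1]` -/

/-- The integral of a polynomial over `[-1, 1]`. -/
noncomputable def refInt (f : ℝ[X]) : ℝ := ∫ x in (-1 : ℝ)..1, f.eval x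

/-- The constant term of the `p`-th derivative. -/
noncomputable def topDeriv (p : ℕ) (f : ℝ[X]) : ℝ := (derivative^[p] f).coeff 0

lemma refInt_add (f g : ℝ[X]) : refInt (f + g) = refInt f + refInt g := by
  simp only [refInt, eval_add]
  exact intervalIntegral.integral_add (f.continuous.intervalIntegrable _ _)
    (g.continuous.intervalIntegrable _ _)

lemma refInt_neg (f : ℝ[X]) : refInt (-f) = -refInt f := by
  simp only [refInt, eval_neg]
  exact intervalIntegral.integral_neg

lemma refInt_C_mul (a : ℝ) (f : ℝ[X]) : refInt (C a * f) = a * refInt f := by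
  simp only [refInt, eval_mul, eval_C]
  exact intervalIntegral.integral_const_mul _ _

lemma refInt_C (a : ℝ) : refInt (C a) = 2 * a := by
  simp only [refInt, eval_C, intervalIntegral.integral_const, smul_eq_mul]
  norm_num

lemma refInt_sum {ι : Type*} (s : Finset ι) (f : ι → ℝ[X]) :
    refInt (∑ i ∈ s, f i) = ∑ i ∈ s, refInt (f i) := by
  simp only [refInt, eval_finsetSum]
  exact intervalIntegral.integral_finsetSum
    fun i _ => (f i).continuous.intervalIntegrable _ _

lemma refInt_derivative (f : ℝ[X]) : refInt (derivative f) = f.eval 1 - f.eval (-1) :=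
  intervalIntegral.integral_eq_sub_of_hasDerivAt (fun x _ => f.hasDerivAt x)
    ((derivative f).continuous.intervalIntegrable _ _)

lemma eq_zero_of_refInt_eq_zero {f : ℝ[X]} (h0 : ∀ x ∈ Set.Icc (-1 : ℝ) 1, 0 ≤ f.eval x)
    (h : refInt f = 0) : f = 0 := by
  apply eq_zero_of_infinite_isRoot
  refine (Set.Icc_infinite (show (-1 : ℝ) < 1 by norm_num)).mono fun x hx => ?_
  by_contra hne
  have hpos : 0 < f.eval x := lt_of_le_of_ne (h0 x hx) (Ne.symm hne)
  have := intervalIntegral.integral_pos (show (-1 : ℝ) < 1 by norm_num)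
    f.continuous.continuousOn (fun y hy => h0 y ⟨hy.1.le, hy.2⟩) ⟨x, hx, hpos⟩
  exact this.ne' h

lemma eq_zero_of_refInt_mul_self {f : ℝ[X]} (h : refInt (f * f) = 0) : f = 0 := by
  have := eq_zero_of_refInt_eq_zero (f := f * f)
    (fun x _ => by rw [eval_mul]; exact mul_self_nonneg _) h
  exact mul_self_eq_zero.mp this

lemma eq_zero_of_refInt_weighted {f : ℝ[X]} (h : refInt (f * ((X + 1) * f)) = 0) : f = 0 := by
  have := eq_zero_of_refInt_eq_zero (f := f * ((X + 1) * f))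
    (fun x hx => by
      have : 0 ≤ x + 1 := by linarith [hx.1]
      simp only [eval_mul, eval_add, eval_X, eval_one]
      nlinarith [mul_nonneg this (mul_self_nonneg (f.eval x))]) h
  have hX : (X + 1 : ℝ[X]) ≠ 0 := by simpa using X_add_C_ne_zero (1 : ℝ)
  simpa [hX] using this

lemma refInt_iterate_derivative_mul (k : ℕ) (f w : ℝ[X])
    (hf : ∀ j < k, (derivative^[j] f).eval 1 = 0 ∧ (derivative^[j] f).eval (-1) = 0) :
    refInt (derivative^[k] f * w) = (-1) ^ k * refInt (f * derivative^[k] w) := by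
  induction k generalizing w with
  | zero => simp
  | succ k ih =>
    have h1 := refInt_derivative (derivative^[k] f * w)
    rw [derivative_mul, refInt_add, eval_mul, eval_mul, (hf k (by lia)).1, (hf k (by lia)).2,
      ih _ (fun j hj => hf j (by lia)), ← Function.iterate_succ_apply' derivative k f,
      ← Function.iterate_succ_apply derivative k w] at h1
    rw [pow_succ]
    linarith

/-- Both endpoints are zeros of multiplicity at least `p`, so no boundary terms survive `p`
integrations by parts. -/
lemma iterate_derivative_X_sq_sub_one_pow_eval (p j : ℕ) (hj : j < p) :
    (derivative^[j] ((X ^ 2 - 1 : ℝ[X]) ^ p)).eval 1 = 0 ∧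
      (derivative^[j] ((X ^ 2 - 1 : ℝ[X]) ^ p)).eval (-1) = 0 := by
  have key : ∀ a : ℝ, a ^ 2 = 1 → (derivative^[j] ((X ^ 2 - 1 : ℝ[X]) ^ p)).eval a = 0 := by
    intro a ha
    have hd : (X - C a) ∣ (X ^ 2 - 1 : ℝ[X]) := by
      rw [dvd_iff_isRoot]; simp [ha]
    have h2 := pow_sub_dvd_iterate_derivative_of_pow_dvd j (pow_dvd_pow_of_dvd hd p)
    have h3 : (X - C a) ∣ derivative^[j] ((X ^ 2 - 1 : ℝ[X]) ^ p) :=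
      (dvd_pow_self _ (by lia)).trans h2
    exact dvd_iff_isRoot.mp h3
  exact ⟨key 1 (by norm_num), key (-1) (by norm_num)⟩

/-- Integrating the derivative of `X (1 - X²) ^ (p + 1)`, which vanishes at both endpoints, gives
the recursion `(2p + 3) I_{p+1} = (2p + 2) I_p`. -/
lemma refInt_one_sub_X_sq_pow (p : ℕ) :
    refInt ((1 - X ^ 2 : ℝ[X]) ^ p) =
      2 ^ (2 * p + 1) * (p.factorial : ℝ) ^ 2 / ((2 * p + 1).factorial : ℝ) := by
  induction p with
  | zero => simpa using refInt_C 1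
  | succ p ih =>
    have h := refInt_derivative (X * (1 - X ^ 2 : ℝ[X]) ^ (p + 1))
    have e : derivative (X * (1 - X ^ 2 : ℝ[X]) ^ (p + 1)) =
        C (2 * p + 3 : ℝ) * (1 - X ^ 2) ^ (p + 1) + C (-(2 * p + 2) : ℝ) * (1 - X ^ 2) ^ p := by
      simp only [derivative_mul, derivative_X, derivative_pow_succ, derivative_sub, derivative_one]
      simp only [map_add, map_mul, map_neg, map_ofNat, map_natCast, map_one]
      ring
    rw [e, refInt_add, refInt_C_mul, refInt_C_mul, ih] at h
    simp at h
    have e1 : (2 * (p + 1) + 1).factorial = (2 * p + 3) * ((2 * p + 2) * (2 * p + 1).factorial) := by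
      rw [show 2 * (p + 1) + 1 = (2 * p + 1) + 1 + 1 by ring, Nat.factorial_succ,
        Nat.factorial_succ]
    have h3 : (2 * p + 3 : ℝ) ≠ 0 := by positivity
    have h4 : ((2 * p + 1).factorial : ℝ) ≠ 0 := by positivity
    rw [e1, Nat.factorial_succ]
    push_cast
    field_simp
    field_simp at h
    ring_nf at h ⊢
    linarith

lemma mem_degreeLT_iff {p : ℕ} {f : ℝ[X]} : f ∈ degreeLT ℝ (p + 1) ↔ f.natDegree ≤ p := by
  rw [mem_degreeLT, degree_lt_iff_coeff_zero, natDegree_le_iff_coeff_eq_zero]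
  rfl

lemma iterate_derivative_eq_C_topDeriv {p : ℕ} {f : ℝ[X]} (hf : f.natDegree ≤ p) :
    derivative^[p] f = C (topDeriv p f) :=
  eq_C_of_natDegree_le_zero ((natDegree_iterate_derivative f p).trans (by lia))

lemma topDeriv_eq_coeff (p : ℕ) (f : ℝ[X]) : topDeriv p f = p.factorial * f.coeff p := by
  simp [topDeriv, coeff_iterate_derivative, Nat.descFactorial_self]

/-! ### The form of `M + K` and the correction polynomial -/

/-- The bilinear form with matrix `M + K`. -/
noncomputable def sobForm (p : ℕ) (c : ℝ) (f g : ℝ[X]) : ℝ :=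
  refInt (f * g) + c * topDeriv p f * topDeriv p g

lemma refInt_rodrigues_mul {p : ℕ} {f : ℝ[X]} (hf : f.natDegree ≤ p) :
    refInt (derivative^[p] ((X ^ 2 - 1) ^ p) * f) =
      topDeriv p f *
        (2 ^ (2 * p + 1) * (p.factorial : ℝ) ^ 2 / ((2 * p + 1).factorial : ℝ)) := by
  rw [refInt_iterate_derivative_mul _ _ _ (iterate_derivative_X_sq_sub_one_pow_eval p),
    iterate_derivative_eq_C_topDeriv hf, mul_comm _ (C _), refInt_C_mul,
    ← refInt_one_sub_X_sq_pow, ← neg_sub (1 : ℝ[X]) (X ^ 2), neg_pow (1 - X ^ 2 : ℝ[X]),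
    show ((-1 : ℝ[X]) ^ p) = C ((-1 : ℝ) ^ p) by simp, refInt_C_mul]
  have : ((-1 : ℝ) ^ p) * (-1) ^ p = 1 := by rw [← mul_pow]; simp
  linear_combination (topDeriv p f * refInt ((1 - X ^ 2) ^ p)) * this

lemma topDeriv_rodrigues (p : ℕ) :
    topDeriv p (derivative^[p] ((X ^ 2 - 1) ^ p)) = (2 * p).factorial := by
  have hm : (X ^ 2 - 1 : ℝ[X]).Monic := by
    simpa using monic_X_pow_sub_C (1 : ℝ) (two_ne_zero)
  have hd : ((X ^ 2 - 1 : ℝ[X]) ^ p).natDegree = 2 * p := by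
    rw [hm.natDegree_pow, show (X ^ 2 - 1 : ℝ[X]) = X ^ 2 - C 1 by simp,
      natDegree_X_pow_sub_C, mul_comm]
  have h := topDeriv_eq_coeff (2 * p) ((X ^ 2 - 1 : ℝ[X]) ^ p)
  have h1 : ((X ^ 2 - 1 : ℝ[X]) ^ p).coeff (2 * p) = 1 := by
    have := (hm.pow p).coeff_natDegree
    rwa [hd] at this
  rw [h1, mul_one] at h
  rw [← h, topDeriv, topDeriv, ← Function.iterate_add_apply, two_mul]

lemma natDegree_rodrigues_le (p : ℕ) :
    (derivative^[p] ((X ^ 2 - 1 : ℝ[X]) ^ p)).natDegree ≤ p := by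
  refine (natDegree_iterate_derivative _ _).trans ?_
  have : ((X ^ 2 - 1 : ℝ[X]) ^ p).natDegree ≤ p * 2 :=
    natDegree_pow_le_of_le p (by compute_degree)
  lia

/-- Testing against the Rodrigues polynomial gives `topDeriv p f * (2p)! * (c - cMinus p) = 0`; this
is where the bound on `c` enters. Once the top derivative vanishes, only the `L²` norm of `f`
remains. -/
lemma eq_zero_of_sobForm_eq_zero {p : ℕ} {c : ℝ} (hc : cMinus p < c) {f : ℝ[X]}
    (hf : f.natDegree ≤ p) (h : ∀ v : ℝ[X], v.natDegree ≤ p → sobForm p c f v = 0) : f = 0 := by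
  have h1 := h _ (natDegree_rodrigues_le p)
  rw [sobForm, mul_comm f, refInt_rodrigues_mul hf, topDeriv_rodrigues] at h1
  have h2 : topDeriv p f = 0 := by
    have h3 : topDeriv p f * ((2 * p).factorial * (c - cMinus p)) = 0 := by
      rw [← h1, cMinus, Nat.factorial_succ]
      push_cast
      field_simp
      ring
    have h4 : ((2 * p).factorial * (c - cMinus p) : ℝ) ≠ 0 :=
      mul_ne_zero (by positivity) (sub_pos.mpr hc).ne'
    exact (mul_eq_zero.mp h3).resolve_right h4
  have h5 := h f hf
  rw [sobForm, h2] at h5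
  exact eq_zero_of_refInt_mul_self (by simpa using h5)

/-- `g` represents evaluation at `-1` with respect to `sobForm`. -/
structure IsCorrection (p : ℕ) (c : ℝ) (g : ℝ[X]) : Prop where
  natDegree_le : g.natDegree ≤ p
  sobForm_eq : ∀ v : ℝ[X], v.natDegree ≤ p → sobForm p c g v = v.eval (-1)

/-- This is what makes the constants of the theorem independent of the basis. -/
lemma IsCorrection.unique {p : ℕ} {c : ℝ} (hc : cMinus p < c) {g g' : ℝ[X]}
    (hg : IsCorrection p c g) (hg' : IsCorrection p c g') : g = g' := by
  rw [← sub_eq_zero]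
  refine eq_zero_of_sobForm_eq_zero hc (natDegree_sub_le_of_le hg.natDegree_le
    hg'.natDegree_le |>.trans (by simp)) fun v hv => ?_
  have h1 := hg.sobForm_eq v hv
  have h2 := hg'.sobForm_eq v hv
  simp only [sobForm] at h1 h2 ⊢
  rw [sub_mul, sub_eq_add_neg, refInt_add, refInt_neg, topDeriv_eq_coeff p (g - g'), coeff_sub,
    mul_sub, ← topDeriv_eq_coeff, ← topDeriv_eq_coeff]
  linear_combination h1 - h2

lemma IsCorrection.ne_zero {p : ℕ} {c : ℝ} {g : ℝ[X]} (hg : IsCorrection p c g) : g ≠ 0 := by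
  rintro rfl
  have := hg.sobForm_eq 1 (by simp)
  simp [sobForm, topDeriv, refInt] at this

/-- Otherwise `g` has degree below `p` (or is zero) and `(X + 1) g` is an admissible test function.
It vanishes at `-1`, so `∫ (x + 1) g² = 0`. -/
lemma IsCorrection.topDeriv_ne_zero {p : ℕ} {c : ℝ} {g : ℝ[X]} (hg : IsCorrection p c g) :
    topDeriv p g ≠ 0 := by
  intro h
  apply hg.ne_zero
  have hcoeff : g.coeff p = 0 := by
    rw [topDeriv_eq_coeff] at h
    exact (mul_eq_zero.mp h).resolve_left (by positivity)
  by_cases hg0 : g = 0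
  · exact hg0
  have hlt : g.natDegree < p := by
    refine lt_of_le_of_ne hg.natDegree_le fun he => hg0 ?_
    rw [← he] at hcoeff
    exact leadingCoeff_eq_zero.mp hcoeff
  have hd : ((X + 1) * g).natDegree ≤ p := by
    refine natDegree_mul_le.trans ?_
    have : (X + 1 : ℝ[X]).natDegree ≤ 1 := by compute_degree
    lia
  have := hg.sobForm_eq _ hd
  rw [sobForm, h] at this
  exact eq_zero_of_refInt_weighted (by simpa using this)

/-- Subtracting a multiple of `(X + 1) ^ (p + 1)` brings `(X + 1) g` down to degree `p` while
keeping the zero at `-1`. The remainder is thus orthogonal to `g`, and a vanishing moment would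
force `∫ (x + 1) g² = 0`. -/
lemma IsCorrection.moment_ne_zero {p : ℕ} {g : ℝ[X]} (hg : IsCorrection p 0 g) :
    refInt (g * (X + 1) ^ (p + 1)) ≠ 0 := by
  intro h
  apply hg.ne_zero
  apply eq_zero_of_refInt_weighted
  have hm : ((X + 1 : ℝ[X]) ^ (p + 1)).Monic := by simpa using (monic_X_add_C (1 : ℝ)).pow (p + 1)
  have hmd : ((X + 1 : ℝ[X]) ^ (p + 1)).natDegree = p + 1 := by
    simpa using natDegree_pow_X_add_C (p + 1) (1 : ℝ)
  set a := g.coeff p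
  set r := (X + 1) * g - C a * (X + 1) ^ (p + 1) with hr
  have hrd : r.natDegree ≤ p := by
    rw [natDegree_le_iff_coeff_eq_zero]
    intro N hN
    rcases Nat.lt_or_ge (p + 1) N with h1 | h1
    · apply coeff_eq_zero_of_natDegree_lt
      refine lt_of_le_of_lt (natDegree_sub_le_of_le (m := p + 1) (n := p + 1) ?_ ?_) (by simpa)
      · refine natDegree_mul_le.trans ?_
        have : (X + 1 : ℝ[X]).natDegree ≤ 1 := by compute_degree
        have := hg.natDegree_le
        lia
      · exact (natDegree_C_mul_le _ _).trans hmd.le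
    · obtain rfl : N = p + 1 := by lia
      have := hm.coeff_natDegree
      rw [hmd] at this
      have h3 : g.coeff (p + 1) = 0 :=
        coeff_eq_zero_of_natDegree_lt (Nat.lt_succ_of_le hg.natDegree_le)
      rw [hr, coeff_sub, coeff_C_mul, this, add_mul, coeff_add, coeff_X_mul, one_mul, h3]
      simp [a]
  have h1 := hg.sobForm_eq r hrd
  have h2 : (X + 1) * g = r + C a * (X + 1) ^ (p + 1) := by rw [hr]; ring
  rw [h2, mul_add, refInt_add, mul_left_comm, refInt_C_mul, h]
  simpa [sobForm, hr] using h1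


lemma sobForm_comm (p : ℕ) (c : ℝ) (f g : ℝ[X]) : sobForm p c f g = sobForm p c g f := by
  rw [sobForm, sobForm, mul_comm f g]; ring

/-! ### From matrices to polynomials -/

section Coordinates

variable {p : ℕ} (χ : PolyBasis p)

/-- The polynomial with given coordinates. -/
noncomputable def coordPoly (a : Fin (p + 1) → ℝ) : ℝ[X] :=
  ((χ.equivFun.symm a : degreeLT ℝ (p + 1)) : ℝ[X])

lemma coordPoly_eq_sum (a : Fin (p + 1) → ℝ) :
    coordPoly χ a = ∑ j, C (a j) * (χ j : ℝ[X]) := by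
  simp [coordPoly, Module.Basis.equivFun_symm_apply, smul_eq_C_mul]

lemma natDegree_coordPoly_le (a : Fin (p + 1) → ℝ) : (coordPoly χ a).natDegree ≤ p :=
  mem_degreeLT_iff.mp (χ.equivFun.symm a).2

lemma coordPoly_eq_zero {a : Fin (p + 1) → ℝ} (h : coordPoly χ a = 0) : a = 0 := by
  have h1 : χ.equivFun.symm a = 0 := Subtype.ext h
  exact (LinearEquiv.map_eq_zero_iff _).mp h1

lemma exists_coordPoly_eq {v : ℝ[X]} (hv : v.natDegree ≤ p) : ∃ a, coordPoly χ a = v :=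
  ⟨χ.equivFun ⟨v, mem_degreeLT_iff.mpr hv⟩, by simp [coordPoly]⟩

lemma coordPoly_diffMatrix_mulVec (a : Fin (p + 1) → ℝ) :
    coordPoly χ (Matrix.mulVec (diffMatrix χ) a) = derivative (coordPoly χ a) := by
  have h := LinearMap.toMatrix_mulVec_repr χ χ (derivOp p) (χ.equivFun.symm a)
  have h1 : (χ.repr (χ.equivFun.symm a) : Fin (p + 1) → ℝ) = a := χ.equivFun.apply_symm_apply a
  rw [h1] at h
  rw [coordPoly, diffMatrix, h]
  have h2 := χ.equivFun.symm_apply_apply (derivOp p (χ.equivFun.symm a))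
  rw [Module.Basis.equivFun_apply] at h2
  rw [h2]
  rfl

lemma coordPoly_diffMatrix_pow_mulVec (k : ℕ) (a : Fin (p + 1) → ℝ) :
    coordPoly χ (Matrix.mulVec (diffMatrix χ ^ k) a) = derivative^[k] (coordPoly χ a) := by
  induction k with
  | zero => simp
  | succ k ih =>
    rw [pow_succ', ← Matrix.mulVec_mulVec, coordPoly_diffMatrix_mulVec, ih,
      Function.iterate_succ_apply']

lemma leftVec_dotProduct (a : Fin (p + 1) → ℝ) :
    leftVec χ ⬝ᵥ a = (coordPoly χ a).eval (-1) := by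
  simp [coordPoly_eq_sum, eval_finsetSum, dotProduct, leftVec, basisEval, mul_comm]

lemma rightVec_dotProduct (a : Fin (p + 1) → ℝ) :
    rightVec χ ⬝ᵥ a = (coordPoly χ a).eval 1 := by
  simp [coordPoly_eq_sum, eval_finsetSum, dotProduct, rightVec, basisEval, mul_comm]

lemma dotProduct_massMatrix_mulVec (a b : Fin (p + 1) → ℝ) :
    a ⬝ᵥ (Matrix.mulVec (massMatrix χ) b) = refInt (coordPoly χ a * coordPoly χ b) := by
  have hM : ∀ m n, massMatrix χ m n = refInt ((χ m : ℝ[X]) * (χ n : ℝ[X])) := by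
    intro m n
    simp [massMatrix, refInt, basisEval]
  rw [coordPoly_eq_sum χ a, coordPoly_eq_sum χ b, Finset.sum_mul_sum, refInt_sum]
  simp only [dotProduct, Matrix.mulVec, hM]
  refine Finset.sum_congr rfl fun m _ => ?_
  rw [refInt_sum, Finset.mul_sum]
  refine Finset.sum_congr rfl fun n _ => ?_
  rw [mul_mul_mul_comm, ← C_mul, refInt_C_mul]
  ring

lemma dotProduct_mass_add_filter_mulVec (c : ℝ) (a b : Fin (p + 1) → ℝ) :
    a ⬝ᵥ (Matrix.mulVec (massMatrix χ + filterMatrix χ c) b) =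
      sobForm p c (coordPoly χ a) (coordPoly χ b) := by
  rw [Matrix.add_mulVec, dotProduct_add, dotProduct_massMatrix_mulVec, filterMatrix,
    Matrix.smul_mulVec, dotProduct_smul, ← Matrix.mulVec_mulVec, ← Matrix.mulVec_mulVec,
    Matrix.dotProduct_mulVec, Matrix.vecMul_transpose, dotProduct_massMatrix_mulVec,
    coordPoly_diffMatrix_pow_mulVec, coordPoly_diffMatrix_pow_mulVec,
    iterate_derivative_eq_C_topDeriv (natDegree_coordPoly_le χ a),
    iterate_derivative_eq_C_topDeriv (natDegree_coordPoly_le χ b), ← C_mul, refInt_C, sobForm,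
    smul_eq_mul]
  ring

lemma isUnit_mass_add_filter {c : ℝ} (hc : cMinus p < c) :
    IsUnit (massMatrix χ + filterMatrix χ c) := by
  rw [← Matrix.mulVec_injective_iff_isUnit, ← Matrix.coe_mulVecLin,
    injective_iff_map_eq_zero]
  intro a ha
  refine coordPoly_eq_zero χ (eq_zero_of_sobForm_eq_zero hc (natDegree_coordPoly_le χ a) ?_)
  intro v hv
  obtain ⟨b, rfl⟩ := exists_coordPoly_eq χ hv
  rw [sobForm_comm, ← dotProduct_mass_add_filter_mulVec]
  rw [Matrix.mulVecLin_apply] at ha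
  rw [ha, dotProduct_zero]

lemma isCorrection_corrVec {c : ℝ} (hc : cMinus p < c) :
    IsCorrection p c (coordPoly χ (corrVec χ c)) := by
  refine ⟨natDegree_coordPoly_le χ _, fun v hv => ?_⟩
  obtain ⟨b, rfl⟩ := exists_coordPoly_eq χ hv
  have hu := (Matrix.isUnit_iff_isUnit_det _).mp (isUnit_mass_add_filter χ hc)
  rw [sobForm_comm, ← dotProduct_mass_add_filter_mulVec, corrVec, Matrix.mulVec_mulVec,
    Matrix.mul_nonsing_inv _ hu, Matrix.one_mulVec, dotProduct_comm, leftVec_dotProduct]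

end Coordinates

/-! ### The scalar characteristic equation -/

/-- The eigenvalue equation of a rank one perturbation of a nilpotent operator. -/
lemma exists_nilpotent_add_rankOne_eigenvector_iff {V : Type*} [AddCommGroup V] [Module ℂ V]
    {p : ℕ} {D : Module.End ℂ V} (hD : D ^ (p + 1) = 0) {g : V} {φ : V →ₗ[ℂ] ℂ}
    (hg : (D ^ p) g ≠ 0) (hφ : ∀ x, x ≠ 0 → D x = 0 → φ x = 0 → φ ((D ^ p) g) = 0) (μ : ℂ) :
    (∃ x, x ≠ 0 ∧ D x + φ x • g = μ • x) ↔
      μ ^ (p + 1) - ∑ k ∈ Finset.range (p + 1), μ ^ (p - k) * φ ((D ^ k) g) = 0 := by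
  -- Since `D ^ (p + 1) = 0`, the geometric sum `A` satisfies `A (D - μ) = (D - μ) A = -μ ^ (p +
  -- 1)`: up to that factor it inverts `D - μ`.
  set A : Module.End ℂ V := ∑ k ∈ Finset.range (p + 1),
    D ^ k * (algebraMap ℂ (Module.End ℂ V) μ) ^ (p + 1 - 1 - k) with hA
  have hcomm : Commute D (algebraMap ℂ (Module.End ℂ V) μ) := (Algebra.commutes μ D).symm
  have hpow : ∀ (n : ℕ) (x : V), ((algebraMap ℂ (Module.End ℂ V) μ) ^ n) x = μ ^ n • x := by
    intro n x
    rw [← map_pow, Module.algebraMap_end_apply]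
  have h1 : ∀ x, A (D x - μ • x) = -(μ ^ (p + 1) • x) := by
    intro x
    have := LinearMap.congr_fun (hcomm.geom_sum₂_mul (p + 1)) x
    rw [← hA, hD] at this
    simpa [hpow, Module.algebraMap_end_apply] using this
  have h2 : ∀ x, D (A x) - μ • A x = -(μ ^ (p + 1) • x) := by
    intro x
    have := LinearMap.congr_fun (hcomm.mul_geom_sum₂ (p + 1)) x
    rw [← hA, hD] at this
    simpa [hpow, Module.algebraMap_end_apply] using this
  have hAx : ∀ x, A x = ∑ k ∈ Finset.range (p + 1), μ ^ (p - k) • (D ^ k) x := by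
    intro x
    rw [hA, LinearMap.sum_apply]
    refine Finset.sum_congr rfl fun k _ => ?_
    simp [hpow]
  have hφA : φ (A g) = ∑ k ∈ Finset.range (p + 1), μ ^ (p - k) * φ ((D ^ k) g) := by
    simp [hAx]
  have hA0 : μ = 0 → A g = (D ^ p) g := by
    rintro rfl
    rw [hAx, Finset.sum_range_succ, Finset.sum_eq_zero]
    · simp
    · intro k hk
      rw [zero_pow, zero_smul]
      have := Finset.mem_range.mp hk
      lia
  rw [← hφA, sub_eq_zero]
  constructor
  · rintro ⟨x, hx, he⟩
    have h3 : D x - μ • x = -(φ x • g) := by rw [← he, sub_add_cancel_left]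
    have h4 := h1 x
    rw [h3, map_neg, map_smul, neg_inj] at h4
    -- If `φ x = 0`, then `μ = 0` and `D x = 0`; this is the degenerate case covered by `hφ`.
    by_cases hs : φ x = 0
    · rw [hs, zero_smul] at h4
      have hμ : μ = 0 := by
        have := (smul_eq_zero.mp h4.symm).resolve_right hx
        exact pow_eq_zero_iff (by lia) |>.mp this
      rw [hA0 hμ, hφ x hx _ hs, hμ]
      · simp
      · rw [hs, hμ] at he; simpa using he
    · have h5 := congrArg φ h4
      rw [map_smul, map_smul, smul_eq_mul, smul_eq_mul, mul_comm] at h5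
      exact (mul_right_cancel₀ hs h5).symm
  · intro h
    -- The eigenvector is `A g`. It can vanish only if `μ = 0`, but then it equals `(D ^ p) g ≠ 0`.
    refine ⟨A g, fun h0 => ?_, ?_⟩
    · have h3 := h2 g
      rw [h0] at h3
      simp only [map_zero, smul_zero, sub_zero] at h3
      have hg0 : g ≠ 0 := by rintro rfl; simp at hg
      have hμ : μ = 0 := by
        have := (smul_eq_zero.mp (neg_eq_zero.mp h3.symm)).resolve_right hg0
        exact pow_eq_zero_iff (by lia) |>.mp this
      exact hg (by rw [← hA0 hμ, h0])
    · have h3 := h2 g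
      rw [← h]
      rw [sub_eq_iff_eq_add] at h3
      rw [h3]; module

/-- The characteristic function of the scheme with correction `g`: `ω` is an eigenvalue of the
von Neumann matrix iff `i ω / 2` is a zero for `z = exp (-iθ)`. -/
noncomputable def charFun (p : ℕ) (g : ℝ[X]) (z μ : ℂ) : ℂ :=
  μ ^ (p + 1) - ∑ k ∈ Finset.range (p + 1), μ ^ (p - k) *
    (((derivative^[k] g).eval (-1) : ℝ) - z * ((derivative^[k] g).eval 1 : ℝ))

section Eigen

variable {p : ℕ} (χ : PolyBasis p)

lemma map_pow_mulVec_ofReal (k : ℕ) (a : Fin (p + 1) → ℝ) :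
    Matrix.mulVec (((diffMatrix χ).map Complex.ofReal) ^ k) (fun j => (a j : ℂ)) =
      fun j => ((Matrix.mulVec (diffMatrix χ ^ k) a j : ℝ) : ℂ) := by
  have h : ((diffMatrix χ).map Complex.ofReal) ^ k =
      (diffMatrix χ ^ k).map Complex.ofRealHom :=
    (Matrix.map_pow (diffMatrix χ) Complex.ofRealHom k).symm
  rw [h]
  ext i
  exact (RingHom.map_mulVec Complex.ofRealHom (diffMatrix χ ^ k) a i).symm

lemma diffMatrix_pow_eq_zero : diffMatrix χ ^ (p + 1) = 0 := by
  apply Matrix.ext_of_mulVec_single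
  intro i
  rw [Matrix.zero_mulVec]
  apply coordPoly_eq_zero χ
  rw [coordPoly_diffMatrix_pow_mulVec]
  exact iterate_derivative_eq_zero (Nat.lt_succ_of_le (natDegree_coordPoly_le χ _))

/-- The jump functional `x ↦ l ⬝ x - z r ⬝ x`. -/
noncomputable def jump (z : ℂ) : (Fin (p + 1) → ℂ) →ₗ[ℂ] ℂ where
  toFun x := (fun j => (leftVec χ j : ℂ)) ⬝ᵥ x - z * ((fun j => (rightVec χ j : ℂ)) ⬝ᵥ x)
  map_add' x y := by simp only [dotProduct_add]; ring
  map_smul' s x := by simp only [dotProduct_smul, smul_eq_mul, RingHom.id_apply]; ring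

lemma jump_ofReal (z : ℂ) (a : Fin (p + 1) → ℝ) :
    jump χ z (fun j => (a j : ℂ)) =
      ((coordPoly χ a).eval (-1) : ℝ) - z * ((coordPoly χ a).eval 1 : ℝ) := by
  rw [← leftVec_dotProduct, ← rightVec_dotProduct]
  simp [jump, dotProduct]

lemma vonNeumann_mulVec (c θ : ℝ) (x : Fin (p + 1) → ℂ) :
    Matrix.mulVec (vonNeumann χ c θ) x = (-2 * Complex.I) •
      (Matrix.mulVec ((diffMatrix χ).map Complex.ofReal) x +
        jump χ (Complex.exp (-(Complex.I * θ))) x • fun j => (corrVec χ c j : ℂ)) := by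
  have hv : ∀ u w : Fin (p + 1) → ℝ,
      Matrix.mulVec ((Matrix.vecMulVec u w).map Complex.ofReal) x =
        ((fun j => (w j : ℂ)) ⬝ᵥ x) • fun j => (u j : ℂ) := by
    intro u w
    ext i
    simp only [Matrix.mulVec, dotProduct, Matrix.map_apply, Matrix.vecMulVec_apply,
      Complex.ofReal_mul, Pi.smul_apply, smul_eq_mul, Finset.sum_mul]
    exact Finset.sum_congr rfl fun j _ => by ring
  rw [vonNeumann, Matrix.smul_mulVec, Matrix.sub_mulVec, Matrix.add_mulVec, Matrix.smul_mulVec,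
    hv, hv]
  simp only [jump, LinearMap.coe_mk, AddHom.coe_mk, sub_smul, mul_smul]
  rw [add_sub_assoc]

lemma eval_eq_of_diffMatrix_mulVec_eq_zero {a : Fin (p + 1) → ℝ}
    (h : Matrix.mulVec (diffMatrix χ) a = 0) : ∃ s : ℝ, coordPoly χ a = C s := by
  have := coordPoly_diffMatrix_mulVec χ a
  rw [h] at this
  have h0 : derivative (coordPoly χ a) = 0 := by
    rw [← this]; simp [coordPoly]
  exact ⟨_, eq_C_of_derivative_eq_zero h0⟩

/-- The kernel of `D` consists of the constants, on which the jump is multiplication by `1 - z`.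
Real and imaginary parts are separated because `coordPoly` takes real coordinates. -/
lemma eq_one_of_jump_eq_zero {z : ℂ} {x : Fin (p + 1) → ℂ} (hx : x ≠ 0)
    (hD : Matrix.mulVec ((diffMatrix χ).map Complex.ofReal) x = 0) (hj : jump χ z x = 0) :
    z = 1 := by
  set a : Fin (p + 1) → ℝ := fun j => (x j).re
  set b : Fin (p + 1) → ℝ := fun j => (x j).im
  have ha : Matrix.mulVec (diffMatrix χ) a = 0 := by
    ext i
    have := congrArg Complex.re (congrFun hD i)
    simpa [Matrix.mulVec, dotProduct] using this
  have hb : Matrix.mulVec (diffMatrix χ) b = 0 := by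
    ext i
    have := congrArg Complex.im (congrFun hD i)
    simpa [Matrix.mulVec, dotProduct] using this
  obtain ⟨s, hs⟩ := eval_eq_of_diffMatrix_mulVec_eq_zero χ ha
  obtain ⟨t, ht⟩ := eval_eq_of_diffMatrix_mulVec_eq_zero χ hb
  have hxab : x = (fun j => (a j : ℂ)) + Complex.I • fun j => (b j : ℂ) := by
    ext j
    simp [a, b, mul_comm Complex.I, Complex.re_add_im]
  rw [hxab, map_add, map_smul, jump_ofReal, jump_ofReal, hs, ht] at hj
  simp only [eval_C, smul_eq_mul] at hj
  have h1 : ((s : ℂ) + t * Complex.I) * (1 - z) = 0 := by linear_combination hj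
  rcases mul_eq_zero.mp h1 with h2 | h2
  · exfalso
    apply hx
    have hs0 : s = 0 := by simpa using congrArg Complex.re h2
    have ht0 : t = 0 := by simpa using congrArg Complex.im h2
    have ha0 := coordPoly_eq_zero χ (hs.trans (by rw [hs0, C_0]))
    have hb0 := coordPoly_eq_zero χ (ht.trans (by rw [ht0, C_0]))
    rw [hxab, ha0, hb0]
    ext; simp
  · exact (sub_eq_zero.mp h2).symm

lemma hasEigenvalue_vonNeumann_iff {c : ℝ} (hc : cMinus p < c) (θ : ℝ) (ω : ℂ) :
    Module.End.HasEigenvalue (Matrix.toLin' (vonNeumann χ c θ)) ω ↔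
      charFun p (coordPoly χ (corrVec χ c)) (Complex.exp (-(Complex.I * θ)))
        (Complex.I * ω / 2) = 0 := by
  set z := Complex.exp (-(Complex.I * θ))
  set g : Fin (p + 1) → ℂ := fun j => (corrVec χ c j : ℂ)
  set D : Module.End ℂ (Fin (p + 1) → ℂ) := Matrix.toLin' ((diffMatrix χ).map Complex.ofReal)
    with hDdef
  have hpow : ∀ k, (D ^ k) g =
      fun j => ((Matrix.mulVec (diffMatrix χ ^ k) (corrVec χ c) j : ℝ) : ℂ) := by
    intro k
    rw [hDdef, ← Matrix.toLin'_pow, Matrix.toLin'_apply, map_pow_mulVec_ofReal]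
  have hjump : ∀ k, jump χ z ((D ^ k) g) =
      ((derivative^[k] (coordPoly χ (corrVec χ c))).eval (-1) : ℝ)
        - z * ((derivative^[k] (coordPoly χ (corrVec χ c))).eval 1 : ℝ) := by
    intro k
    rw [hpow, jump_ofReal, coordPoly_diffMatrix_pow_mulVec]
  have hcor := isCorrection_corrVec χ hc
  have hD0 : D ^ (p + 1) = 0 := by
    have : ((diffMatrix χ).map Complex.ofReal) ^ (p + 1) = 0 := by
      have h := Matrix.map_pow (diffMatrix χ) Complex.ofRealHom (p + 1)
      rw [diffMatrix_pow_eq_zero] at h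
      refine Eq.trans h.symm ?_
      ext; simp
    rw [hDdef, ← Matrix.toLin'_pow, this, map_zero]
  have hg : (D ^ p) g ≠ 0 := by
    intro h
    rw [hpow] at h
    have h0 : Matrix.mulVec (diffMatrix χ ^ p) (corrVec χ c) = 0 := by
      ext j
      exact Complex.ofReal_eq_zero.mp (congrFun h j)
    have := coordPoly_diffMatrix_pow_mulVec χ p (corrVec χ c)
    rw [h0, iterate_derivative_eq_C_topDeriv hcor.natDegree_le] at this
    apply hcor.topDeriv_ne_zero
    rw [← C_eq_zero, ← this]
    simp [coordPoly]
  -- In the degenerate case `z = 1`, and `(D ^ p) g` is a constant polynomial, so its jump is zero.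
  have key := exists_nilpotent_add_rankOne_eigenvector_iff hD0 (φ := jump χ z) hg
    (fun x hx hDx hjx => by
      rw [eq_one_of_jump_eq_zero χ hx hDx hjx] at hjump ⊢
      rw [hjump, iterate_derivative_eq_C_topDeriv hcor.natDegree_le]
      simp) (Complex.I * ω / 2)
  simp only [hjump] at key
  rw [charFun, ← key]
  have heq : ∀ x, Matrix.toLin' (vonNeumann χ c θ) x = ω • x ↔
      D x + jump χ z x • g = (Complex.I * ω / 2) • x := by
    intro x
    rw [Matrix.toLin'_apply, vonNeumann_mulVec, hDdef, Matrix.toLin'_apply]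
    have hI : (-2 * Complex.I) ≠ 0 := by simp
    have : ω • x = (-2 * Complex.I) • (Complex.I * ω / 2) • x := by
      rw [smul_smul]
      congr 1
      linear_combination ω * Complex.I_mul_I
    rw [this, smul_right_inj hI]
  constructor
  · intro h
    obtain ⟨x, hx⟩ := h.exists_hasEigenvector
    exact ⟨x, hx.2, (heq x).mp hx.apply_eq_smul⟩
  · rintro ⟨x, hx, he⟩
    exact Module.End.hasEigenvalue_of_hasEigenvector
      ⟨Module.End.mem_eigenspace_iff.mpr ((heq x).mpr he), hx⟩

end Eigen


/-! ### Order of the defect at the exact relation -/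

section CharFun

variable (p : ℕ) (g : ℝ[X])

lemma sum_pow_mul_iterate_derivative (x : ℝ) (μ : ℂ) (hg : g.natDegree ≤ p) :
    ∑ k ∈ Finset.range (p + 1), μ ^ (p - k) * ((derivative^[k + 1] g).eval x : ℝ) =
      μ * ∑ k ∈ Finset.range (p + 1), μ ^ (p - k) * ((derivative^[k] g).eval x : ℝ) -
        μ ^ (p + 1) * (g.eval x : ℝ) := by
  have h := Finset.sum_range_sub'
    (fun k => μ ^ (p + 1 - k) * (((derivative^[k] g).eval x : ℝ) : ℂ)) (p + 1)
  have h0 : derivative^[p + 1] g = 0 := iterate_derivative_eq_zero (Nat.lt_succ_of_le hg)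
  simp only [h0, eval_zero, Complex.ofReal_zero, mul_zero, sub_zero, Function.iterate_zero,
    id_eq, Nat.sub_zero] at h
  rw [← h, Finset.mul_sum, ← Finset.sum_sub_distrib]
  refine Finset.sum_congr rfl fun k hk => ?_
  have hk' : k ≤ p := Nat.lt_succ_iff.mp (Finset.mem_range.mp hk)
  rw [Nat.sub_add_comm hk', Nat.add_sub_add_right, pow_succ]
  ring

/-- The Laplace type transform of `g` over `[-1, 1]`. -/
noncomputable def expMoment (μ : ℂ) : ℂ :=
  ∫ x in (-1 : ℝ)..1, ((g.eval x : ℝ) : ℂ) * Complex.exp (-μ * (x + 1))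

/-- The sum `P = ∑ μ ^ (p - k) g⁽ᵏ⁾` solves `P' = μ P - μ ^ (p + 1) g`, so `P exp (-μ(x + 1))` has
derivative `-μ ^ (p + 1) g exp (-μ(x + 1))`. Its endpoint values produce `charFun`. -/
lemma charFun_exp_eq (hg : g.natDegree ≤ p) (μ : ℂ) :
    charFun p g (Complex.exp (-(2 * μ))) μ = μ ^ (p + 1) * (1 - expMoment g μ) := by
  set P : ℝ → ℂ := fun x =>
    ∑ k ∈ Finset.range (p + 1), μ ^ (p - k) * ((derivative^[k] g).eval x : ℝ)
  have hP : ∀ x, HasDerivAt P (∑ k ∈ Finset.range (p + 1),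
      μ ^ (p - k) * ((derivative^[k + 1] g).eval x : ℝ)) x := by
    intro x
    refine HasDerivAt.fun_sum fun k _ => HasDerivAt.const_mul _ ?_
    rw [Function.iterate_succ_apply']
    exact ((derivative^[k] g).hasDerivAt x).ofReal_comp
  have hE : ∀ x : ℝ, HasDerivAt (fun x : ℝ => Complex.exp (-μ * (x + 1)))
      (Complex.exp (-μ * (x + 1)) * (-μ * 1)) x := by
    intro x
    have h1 : HasDerivAt (fun x : ℝ => (x : ℂ) + 1) 1 x :=
      (hasDerivAt_id x).ofReal_comp.add_const 1
    exact (h1.const_mul (-μ)).cexp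
  have hI := intervalIntegral.integral_eq_sub_of_hasDerivAt (a := -1) (b := 1)
    (f := fun x => P x * Complex.exp (-μ * (x + 1)))
    (f' := fun x => -μ ^ (p + 1) * (((g.eval x : ℝ) : ℂ) * Complex.exp (-μ * (x + 1))))
    (fun x _ => by
      refine ((hP x).mul (hE x)).congr_deriv ?_
      rw [sum_pow_mul_iterate_derivative p g x μ hg]
      ring)
    (by
      apply Continuous.intervalIntegrable
      have := g.continuous
      fun_prop)
  rw [intervalIntegral.integral_const_mul] at hI
  change -μ ^ (p + 1) * expMoment g μ = _ at hI
  have h1 : Complex.exp (-μ * ((1 : ℝ) + 1)) = Complex.exp (-(2 * μ)) := by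
    congr 1; push_cast; ring
  have h2 : Complex.exp (-μ * ((-1 : ℝ) + 1)) = 1 := by simp
  rw [h1, h2] at hI
  have h3 : charFun p g (Complex.exp (-(2 * μ))) μ =
      μ ^ (p + 1) - (P (-1) - Complex.exp (-(2 * μ)) * P 1) := by
    simp only [charFun, P, Finset.mul_sum, ← Finset.sum_sub_distrib]
    congr 1
    refine Finset.sum_congr rfl fun k _ => by ring
  rw [h3]
  linear_combination -hI

lemma expMoment_sub_sum_isBigO (N : ℕ) :
    (fun μ : ℂ => expMoment g μ - ∑ m ∈ Finset.range N,
      (-μ) ^ m / (m.factorial : ℂ) * (refInt (g * (X + 1) ^ m) : ℝ)) =O[𝓝 0]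
      fun μ => μ ^ N := by
  obtain ⟨B, hB⟩ := isCompact_Icc.exists_bound_of_continuousOn (s := Set.Icc (-1 : ℝ) 1)
    g.continuous.continuousOn
  have hB0 : 0 ≤ B := (norm_nonneg _).trans (hB 0 (by norm_num))
  -- `B` bounds `g`, `2 ^ N * exp 2` comes from `‖μ (x + 1)‖ ≤ 2‖μ‖ ≤ 2`, and the last `2` is the
  -- length of the interval.
  refine IsBigO.of_bound (B * (2 ^ N * Real.exp 2) * 2) ?_
  have hball : Metric.ball (0 : ℂ) 1 ∈ 𝓝 0 := Metric.ball_mem_nhds _ one_pos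
  filter_upwards [hball] with μ hμ
  have hμ1 : ‖μ‖ ≤ 1 := by simpa using (Metric.mem_ball.mp hμ).le
  have hgc := g.continuous
  have hterm : ∀ m, (-μ) ^ m / (m.factorial : ℂ) * (refInt (g * (X + 1) ^ m) : ℝ) =
      ∫ x in (-1 : ℝ)..1, ((g.eval x : ℝ) : ℂ) * ((-μ * (x + 1)) ^ m / m.factorial) := by
    intro m
    rw [refInt, ← intervalIntegral.integral_ofReal, ← intervalIntegral.integral_const_mul]
    refine intervalIntegral.integral_congr fun x _ => ?_
    simp only [eval_mul, eval_pow, eval_add, eval_X, eval_one, mul_pow]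
    push_cast
    ring
  have hsum : expMoment g μ - ∑ m ∈ Finset.range N,
      (-μ) ^ m / (m.factorial : ℂ) * (refInt (g * (X + 1) ^ m) : ℝ) =
      ∫ x in (-1 : ℝ)..1, ((g.eval x : ℝ) : ℂ) * (Complex.exp (-μ * (x + 1)) -
        ∑ m ∈ Finset.range N, (-μ * (x + 1)) ^ m / m.factorial) := by
    rw [expMoment, Finset.sum_congr rfl fun m _ => hterm m,
      ← intervalIntegral.integral_finsetSum, ← intervalIntegral.integral_sub]
    · refine intervalIntegral.integral_congr fun x _ => ?_
      simp only [mul_sub, Finset.mul_sum]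
    · apply Continuous.intervalIntegrable; fun_prop
    · apply Continuous.intervalIntegrable; fun_prop
    · intro m _
      apply Continuous.intervalIntegrable; fun_prop
  rw [hsum]
  refine (intervalIntegral.norm_integral_le_of_norm_le_const
    (C := B * (2 ^ N * Real.exp 2) * ‖μ‖ ^ N) fun x hx => ?_).trans ?_
  · rw [Set.uIoc_of_le (by norm_num)] at hx
    have hx1 : ‖-μ * ((x : ℂ) + 1)‖ ≤ 2 * ‖μ‖ := by
      have : ‖(x : ℂ) + 1‖ ≤ 2 := by
        rw [← Complex.ofReal_one, ← Complex.ofReal_add, Complex.norm_real, Real.norm_eq_abs,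
          abs_le]
        constructor <;> linarith [hx.1, hx.2]
      rw [norm_mul, norm_neg, mul_comm]
      gcongr
    have hexp := Complex.norm_exp_sub_sum_le_norm_mul_exp (-μ * ((x : ℂ) + 1)) N
    rw [norm_mul, Complex.norm_real]
    have hgx := hB x ⟨hx.1.le, hx.2⟩
    calc _ ≤ B * (‖-μ * ((x : ℂ) + 1)‖ ^ N * Real.exp ‖-μ * ((x : ℂ) + 1)‖) := by gcongr
      _ ≤ B * ((2 * ‖μ‖) ^ N * Real.exp 2) := by
        gcongr
        linarith
      _ = _ := by rw [mul_pow]; ring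
  · rw [norm_pow]
    apply le_of_eq
    norm_num
    ring

variable {p g}

lemma topDeriv_X_add_one_pow (p m : ℕ) (hm : m ≤ p) :
    topDeriv p ((X + 1) ^ m) = if m = p then (p.factorial : ℝ) else 0 := by
  rw [topDeriv_eq_coeff, coeff_X_add_one_pow]
  split_ifs with h
  · simp [h]
  · rw [Nat.choose_eq_zero_of_lt (by lia)]; simp

lemma IsCorrection.refInt_mul_X_add_one_pow {c : ℝ} (hg : IsCorrection p c g) {m : ℕ}
    (hm : m ≤ p) : refInt (g * (X + 1) ^ m) =
      (if m = 0 then 1 else 0) - c * topDeriv p g * if m = p then (p.factorial : ℝ) else 0 := by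
  have hd : ((X + 1 : ℝ[X]) ^ m).natDegree ≤ p := by
    have : ((X + 1 : ℝ[X]) ^ m).natDegree = m := by simpa using natDegree_pow_X_add_C m (1 : ℝ)
    lia
  have h := hg.sobForm_eq _ hd
  rw [sobForm, topDeriv_X_add_one_pow p m hm] at h
  have h0 : ((X + 1 : ℝ[X]) ^ m).eval (-1) = if m = 0 then 1 else 0 := by
    simp [zero_pow_eq]
  linarith

lemma IsCorrection.sum_moments {c : ℝ} (hg : IsCorrection p c g) (μ : ℂ) :
    ∑ m ∈ Finset.range (p + 1),
      (-μ) ^ m / (m.factorial : ℂ) * (refInt (g * (X + 1) ^ m) : ℝ) =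
      1 - ((-1) ^ p * (c * topDeriv p g : ℝ)) * μ ^ p := by
  have h : ∀ m ∈ Finset.range (p + 1),
      (-μ) ^ m / (m.factorial : ℂ) * ((refInt (g * (X + 1) ^ m) : ℝ) : ℂ) =
      (if m = 0 then 1 else 0) - if m = p then
        ((-1) ^ p * (c * topDeriv p g : ℝ)) * μ ^ p else 0 := by
    intro m hm
    rw [hg.refInt_mul_X_add_one_pow (Nat.lt_succ_iff.mp (Finset.mem_range.mp hm))]
    have hf : (p.factorial : ℂ) ≠ 0 := by exact_mod_cast p.factorial_ne_zero
    have h2 : (-μ) ^ p = (-1) ^ p * μ ^ p := by rw [← mul_pow, neg_one_mul]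
    by_cases h0 : m = 0 <;> by_cases h1 : m = p
    · subst h0; subst h1; simp
    · subst h0; simp [h1]
    · subst h1; simp only [h0, if_true, if_false, zero_sub, h2]; push_cast; field_simp
    · simp [h0, h1]
  rw [Finset.sum_congr rfl h, Finset.sum_sub_distrib]
  simp

/-- The order of vanishing of the consistency defect. -/
noncomputable def errOrder (p : ℕ) (c : ℝ) : ℕ := if c = 0 then 2 * p + 2 else 2 * p + 1

lemma isTheta_pow_of_sub_isBigO {f : ℂ → ℂ} {κ : ℂ} (hκ : κ ≠ 0) (n : ℕ)
    (h : (fun μ => f μ - κ * μ ^ n) =O[𝓝 0] fun μ => μ ^ (n + 1)) :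
    f =Θ[𝓝 0] fun μ => μ ^ n := by
  have h1 : (fun μ : ℂ => μ ^ (n + 1)) =o[𝓝 0] fun μ => μ ^ n :=
    isLittleO_pow_pow (Nat.lt_succ_self n)
  have h2 : (fun μ : ℂ => κ * μ ^ n) =Θ[𝓝 0] fun μ => μ ^ n :=
    (isTheta_const_mul_left hκ).mpr (isTheta_refl _ _)
  have h3 : IsEquivalent (𝓝 0) f (fun μ => κ * μ ^ n) :=
    (h.trans_isLittleO h1).trans_isTheta h2.symm
  exact h3.isTheta.trans h2

/-- For `c ≠ 0` the `c`-term in moment `p` leads. For `c = 0` all moments up to `p` match those of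
the point mass, and moment `p + 1` leads. -/
lemma IsCorrection.one_sub_expMoment_isTheta {c : ℝ} (hg : IsCorrection p c g) :
    (fun μ => 1 - expMoment g μ) =Θ[𝓝 0] fun μ => μ ^ (if c = 0 then p + 1 else p) := by
  split_ifs with hc
  · subst hc
    have h := expMoment_sub_sum_isBigO g (p + 1 + 1)
    refine isTheta_pow_of_sub_isBigO
      (κ := -((-1) ^ (p + 1) / ((p + 1).factorial : ℂ) * (refInt (g * (X + 1) ^ (p + 1)) : ℝ)))
      ?_ _ (h.neg_left.congr_left fun μ => ?_)
    · have h1 : ((p + 1).factorial : ℂ) ≠ 0 := by exact_mod_cast (p + 1).factorial_ne_zero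
      have h2 : ((refInt (g * (X + 1) ^ (p + 1)) : ℝ) : ℂ) ≠ 0 := by
        exact_mod_cast hg.moment_ne_zero
      exact neg_ne_zero.mpr (mul_ne_zero (div_ne_zero (pow_ne_zero _ (by norm_num)) h1) h2)
    · rw [Finset.sum_range_succ, hg.sum_moments]
      have h2 : (-μ) ^ (p + 1) = (-1) ^ (p + 1) * μ ^ (p + 1) := by rw [← mul_pow, neg_one_mul]
      rw [h2]
      push_cast
      ring
  · have h := expMoment_sub_sum_isBigO g (p + 1)
    refine isTheta_pow_of_sub_isBigO (κ := (-1) ^ p * (c * topDeriv p g : ℝ))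
      ?_ _ (h.neg_left.congr_left fun μ => ?_)
    · have := mul_ne_zero hc hg.topDeriv_ne_zero
      exact mul_ne_zero (pow_ne_zero _ (by norm_num)) (by exact_mod_cast this)
    · rw [hg.sum_moments]
      ring

/-- The value of the characteristic function at the exact relation. -/
noncomputable def defect (p : ℕ) (g : ℝ[X]) (θ : ℝ) : ℂ :=
  charFun p g (Complex.exp (-(Complex.I * θ))) (Complex.I * θ / 2)

lemma isTheta_I_mul_ofReal_pow (N : ℕ) {s : ℂ} (hs : s ≠ 0) :
    (fun θ : ℝ => (s * (θ : ℂ)) ^ N) =Θ[𝓝 0] fun θ : ℝ => θ ^ N := by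
  simp only [mul_pow]
  refine (isTheta_const_mul_left (pow_ne_zero N hs)).mpr ?_
  exact IsTheta.of_norm_eventuallyEq_norm (Eventually.of_forall fun θ => by simp)

lemma IsCorrection.defect_isTheta {c : ℝ} (hg : IsCorrection p c g) :
    defect p g =Θ[𝓝 0] fun θ : ℝ => θ ^ errOrder p c := by
  have ht : Tendsto (fun θ : ℝ => Complex.I / 2 * (θ : ℂ)) (𝓝 0) (𝓝 0) := by
    have : Continuous fun θ : ℝ => Complex.I / 2 * (θ : ℂ) := by fun_prop
    simpa using this.tendsto 0
  have h1 : (fun μ => μ ^ (p + 1) * (1 - expMoment g μ)) =Θ[𝓝 0] fun μ => μ ^ errOrder p c := by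
    have h2 := (isTheta_refl (fun μ : ℂ => μ ^ (p + 1)) (𝓝 0)).mul hg.one_sub_expMoment_isTheta
    have h3 : errOrder p c = p + 1 + if c = 0 then p + 1 else p := by
      rw [errOrder]
      split_ifs <;> lia
    simpa only [h3, pow_add] using h2
  have h3 : defect p g = (fun μ => μ ^ (p + 1) * (1 - expMoment g μ)) ∘
      fun θ : ℝ => Complex.I / 2 * (θ : ℂ) := by
    funext θ
    have h5 : Complex.I * θ / 2 = Complex.I / 2 * θ := by ring
    have h4 : Complex.exp (-(Complex.I * θ)) = Complex.exp (-(2 * (Complex.I / 2 * θ))) := by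
      congr 1; ring
    rw [Function.comp_apply, ← charFun_exp_eq p g hg.natDegree_le, defect, h4, h5]
  rw [h3]
  exact IsTheta.trans ⟨h1.1.comp_tendsto ht, h1.2.comp_tendsto ht⟩ (isTheta_I_mul_ofReal_pow _ (by simp))

end CharFun

/-! ### Order of the comparison function -/

lemma bigF_isTheta (p : ℕ) (c : ℝ) : bigF p c =Θ[𝓝 0] fun θ : ℝ => θ ^ errOrder p c := by
  unfold bigF errOrder
  rw [isTheta_norm_left]
  have hf : ∀ n : ℕ, (n.factorial : ℝ) ≠ 0 := fun n => by positivity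
  split_ifs with hc
  · subst hc
    have hb1 : b1 p 0 = 0 := by simp [b1, fPar]
    have hb2 : (b2 p 0 : ℂ) ≠ 0 := by
      have : b2 p 0 ≠ 0 := by
        simp only [b2, fPar, zero_mul, add_zero, div_one, sub_self, zero_div, zero_add]
        exact div_ne_zero (hf _) (hf _)
      exact_mod_cast this
    simp only [hb1, Complex.ofReal_zero, zero_mul, zero_add]
    exact (isTheta_const_mul_left hb2).mpr (isTheta_I_mul_ofReal_pow _ Complex.I_ne_zero)
  · have hb1 : (b1 p c : ℂ) ≠ 0 := by
      have : b1 p c ≠ 0 := by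
        refine div_ne_zero (mul_ne_zero (fun h => ?_) (hf _)) (hf _)
        -- `f(c) = 1` forces `c = 0`, even where the denominator vanishes, since the quotient is
        -- then `0`.
        rw [fPar, sub_eq_zero, eq_comm, one_div, inv_eq_one, add_eq_left] at h
        have : (0 : ℝ) < ((2 * p + 1) * ((2 * p).factorial : ℝ) ^ 2) /
            (2 ^ (2 * p + 1) * (p.factorial : ℝ) ^ 2) := by positivity
        exact (mul_ne_zero hc this.ne') h
      exact_mod_cast this
    have h1 : (fun μ : ℂ => (b1 p c : ℂ) * μ ^ (2 * p + 1) + (b2 p c : ℂ) * μ ^ (2 * p + 2))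
        =Θ[𝓝 0] fun μ => μ ^ (2 * p + 1) := by
      refine isTheta_pow_of_sub_isBigO hb1 _ ?_
      simp only [add_sub_cancel_left]
      exact (isBigO_refl _ _).const_mul_left _
    have ht : Tendsto (fun θ : ℝ => Complex.I * (θ : ℂ)) (𝓝 0) (𝓝 0) := by
      have : Continuous fun θ : ℝ => Complex.I * (θ : ℂ) := by fun_prop
      simpa using this.tendsto 0
    exact IsTheta.trans ⟨h1.1.comp_tendsto ht, h1.2.comp_tendsto ht⟩ (isTheta_I_mul_ofReal_pow _ Complex.I_ne_zero)


/-! ### Simplicity of the zero and location of roots -/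

/-- The divided difference of `charFun` in its last argument. -/
noncomputable def charQuot (p : ℕ) (g : ℝ[X]) (z μ ν : ℂ) : ℂ :=
  ∑ i ∈ Finset.range (p + 1), μ ^ i * ν ^ (p + 1 - 1 - i) -
    ∑ k ∈ Finset.range (p + 1), (∑ i ∈ Finset.range (p - k), μ ^ i * ν ^ (p - k - 1 - i)) *
      (((derivative^[k] g).eval (-1) : ℝ) - z * ((derivative^[k] g).eval 1 : ℝ))

lemma charFun_sub (p : ℕ) (g : ℝ[X]) (z μ ν : ℂ) :
    charFun p g z μ - charFun p g z ν = charQuot p g z μ ν * (μ - ν) := by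
  rw [charQuot, sub_mul, (Commute.all μ ν).geom_sum₂_mul, Finset.sum_mul]
  have : ∀ k ∈ Finset.range (p + 1),
      (∑ i ∈ Finset.range (p - k), μ ^ i * ν ^ (p - k - 1 - i)) *
      (((derivative^[k] g).eval (-1) : ℝ) - z * ((derivative^[k] g).eval 1 : ℝ)) * (μ - ν) =
      μ ^ (p - k) * (((derivative^[k] g).eval (-1) : ℝ) - z * ((derivative^[k] g).eval 1 : ℝ)) -
      ν ^ (p - k) *
        (((derivative^[k] g).eval (-1) : ℝ) - z * ((derivative^[k] g).eval 1 : ℝ)) := by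
    intro k _
    rw [mul_right_comm, (Commute.all μ ν).geom_sum₂_mul, sub_mul]
  rw [Finset.sum_congr rfl this, Finset.sum_sub_distrib, charFun, charFun]
  ring

lemma continuous_charQuot (p : ℕ) (g : ℝ[X]) :
    Continuous fun q : ℂ × ℂ × ℂ => charQuot p g q.1 q.2.1 q.2.2 := by
  unfold charQuot
  fun_prop

/-- This is the derivative of `charFun p g 1` at `0`. It equals `1` for `p = 0`, and otherwise `∫
g⁽ᵖ⁾ = 2 * topDeriv p g`. -/
lemma IsCorrection.charQuot_ne_zero {p : ℕ} {c : ℝ} {g : ℝ[X]} (hg : IsCorrection p c g) :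
    charQuot p g 1 0 0 ≠ 0 := by
  have hz : ∀ n : ℕ, (∑ i ∈ Finset.range n, (0 : ℂ) ^ i * 0 ^ (n - 1 - i)) =
      if n = 1 then 1 else 0 := by
    intro n
    simp only [← pow_add]
    split_ifs with h
    · simp [h]
    · refine Finset.sum_eq_zero fun i hi => ?_
      have := Finset.mem_range.mp hi
      exact zero_pow (by lia)
  simp only [charQuot, hz]
  cases p with
  | zero => simp
  | succ p =>
    rw [Finset.sum_eq_single p]
    · have h := refInt_derivative (derivative^[p] g)
      rw [← Function.iterate_succ_apply' derivative p g,
        iterate_derivative_eq_C_topDeriv hg.natDegree_le, refInt_C] at h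
      have h1 : p + 1 - p = 1 := by lia
      simp only [h1, if_true, one_mul]
      have h2 : ¬ (p + 1 + 1 = 1) := by lia
      rw [if_neg h2, zero_sub, neg_sub, ← Complex.ofReal_sub, ← h]
      have := hg.topDeriv_ne_zero
      exact_mod_cast mul_ne_zero two_ne_zero this
    · intro k _ hk
      rw [if_neg (by lia), zero_mul]
    · intro h
      exact absurd (Finset.mem_range.mpr (by lia)) h

/-- `‖Q x‖` is the product of the distances from `x` to the roots; the nearest root works. -/
lemma exists_root_norm_sub_pow_le {Q : ℂ[X]} (hQ : Q.Monic) (hd : 0 < Q.natDegree) (x : ℂ) :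
    ∃ r, Q.eval r = 0 ∧ ‖x - r‖ ^ Q.natDegree ≤ ‖Q.eval x‖ := by
  have hs : Q.Splits := IsAlgClosed.splits Q
  have hcard : Q.roots.card = Q.natDegree := hs.natDegree_eq_card_roots.symm
  have hne : Q.roots.toFinset.Nonempty := by
    rw [Multiset.toFinset_nonempty]
    rintro h
    rw [h] at hcard
    simp at hcard
    lia
  obtain ⟨r, hr, hmin⟩ := Q.roots.toFinset.exists_min_image (fun r => ‖x - r‖) hne
  refine ⟨r, (mem_roots hQ.ne_zero).mp (Multiset.mem_toFinset.mp hr), ?_⟩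
  rw [hs.eval_eq_prod_roots_of_monic hQ, ← hcard]
  have key : ∀ s : Multiset ℂ, (∀ t ∈ s, ‖x - r‖ ≤ ‖x - t‖) →
      ‖x - r‖ ^ s.card ≤ ‖(s.map (x - ·)).prod‖ := by
    intro s
    induction s using Multiset.induction_on with
    | empty => simp
    | cons t s ih =>
      intro h
      rw [Multiset.card_cons, pow_succ', Multiset.map_cons, Multiset.prod_cons, norm_mul]
      have h1 := h t (Multiset.mem_cons_self t s)
      have h2 := ih fun u hu => h u (Multiset.mem_cons_of_mem hu)
      gcongr
  exact key _ fun t ht => hmin t (Multiset.mem_toFinset.mpr ht)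

lemma exists_charFun_root (p : ℕ) (g : ℝ[X]) (z x : ℂ) :
    ∃ r, charFun p g z r = 0 ∧ ‖x - r‖ ^ (p + 1) ≤ ‖charFun p g z x‖ := by
  set S : ℂ[X] := ∑ k ∈ Finset.range (p + 1),
    C (((derivative^[k] g).eval (-1) : ℝ) - z * ((derivative^[k] g).eval 1 : ℝ) : ℂ) *
      X ^ (p - k) with hS
  have hSd : S.degree < ((p + 1 : ℕ) : WithBot ℕ) := by
    rw [degree_lt_iff_coeff_zero]
    intro m hm
    rw [hS, finsetSum_coeff]
    refine Finset.sum_eq_zero fun k _ => ?_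
    rw [coeff_C_mul, coeff_X_pow, if_neg (by lia), mul_zero]
  have hmonic : (X ^ (p + 1) - S).Monic := monic_X_pow_sub hSd
  have hdeg : (X ^ (p + 1) - S).natDegree = p + 1 := by
    have h1 : (X ^ (p + 1) - S).degree = ((p + 1 : ℕ) : WithBot ℕ) := by
      rw [degree_sub_eq_left_of_degree_lt (by rwa [degree_X_pow]), degree_X_pow]
    exact natDegree_eq_of_degree_eq_some h1
  have heval : ∀ y, (X ^ (p + 1) - S).eval y = charFun p g z y := by
    intro y
    simp [hS, eval_finsetSum, charFun, mul_comm]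
  obtain ⟨r, hr, hle⟩ := exists_root_norm_sub_pow_le hmonic (by lia) x
  rw [hdeg, heval] at hle
  exact ⟨r, by rw [← heval, hr], hle⟩

lemma tendsto_of_norm_pow_le {f : ℝ → ℂ} {d : ℝ → ℂ} {n : ℕ}
    (h : ∀ θ, ‖f θ‖ ^ n ≤ ‖d θ‖) (hd : Tendsto d (𝓝 0) (𝓝 0)) : Tendsto f (𝓝 0) (𝓝 0) := by
  rw [Metric.tendsto_nhds] at hd ⊢
  intro ε hε
  filter_upwards [hd (ε ^ n) (by positivity)] with θ hθ
  rw [dist_zero_right] at hθ ⊢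
  exact lt_of_pow_lt_pow_left₀ n hε.le ((h θ).trans_lt hθ)

lemma IsCorrection.tendsto_defect {p : ℕ} {c : ℝ} {g : ℝ[X]} (hg : IsCorrection p c g) :
    Tendsto (defect p g) (𝓝 0) (𝓝 0) := by
  refine hg.defect_isTheta.1.trans_tendsto ?_
  have hne : errOrder p c ≠ 0 := by rw [errOrder]; split_ifs <;> lia
  simpa [hne] using (continuous_pow (M := ℝ) (errOrder p c)).tendsto 0

/-! ### The physical branch and its error -/

section Physical

variable {p : ℕ} {c : ℝ} {χ : PolyBasis p}

/-- For each `θ` the root of `charFun` nearest to `iθ/2` is taken; its distance is at most the `(p +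
1)`-th root of the defect, which tends to `0`. No continuity of the choice is needed. -/
lemma exists_isPhysical (hc : cMinus p < c) : ∃ ω : ℝ → ℂ, IsPhysical χ c ω := by
  set g := coordPoly χ (corrVec χ c)
  have hg : IsCorrection p c g := isCorrection_corrVec χ hc
  choose r hr hle using fun θ : ℝ =>
    exists_charFun_root p g (Complex.exp (-(Complex.I * θ))) (Complex.I * θ / 2)
  have ht := tendsto_of_norm_pow_le hle hg.tendsto_defect
  refine ⟨fun θ => -2 * Complex.I * r θ, fun θ => ?_, ?_⟩
  · rw [hasEigenvalue_vonNeumann_iff χ hc]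
    convert hr θ using 2
    linear_combination -r θ * Complex.I_mul_I
  · have h2 := ht.const_mul (2 * Complex.I)
    rw [mul_zero] at h2
    refine h2.congr fun θ => ?_
    linear_combination (θ : ℂ) * Complex.I_mul_I

lemma IsPhysical.tendsto_half {ω : ℝ → ℂ} (hω : IsPhysical χ c ω) :
    Tendsto (fun θ => Complex.I * ω θ / 2) (𝓝 0) (𝓝 0) := by
  have h1 : Tendsto (fun θ : ℝ => (θ : ℂ)) (𝓝 0) (𝓝 0) := by
    simpa using Complex.continuous_ofReal.tendsto 0
  have h2 := (hω.2.add h1).const_mul (Complex.I / 2)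
  rw [add_zero, mul_zero] at h2
  refine h2.congr fun θ => by ring

lemma tendsto_charQuot (g : ℝ[X]) {u v : ℝ → ℂ} (hu : Tendsto u (𝓝 0) (𝓝 0))
    (hv : Tendsto v (𝓝 0) (𝓝 0)) :
    Tendsto (fun θ : ℝ => charQuot p g (Complex.exp (-(Complex.I * θ))) (u θ) (v θ)) (𝓝 0)
      (𝓝 (charQuot p g 1 0 0)) := by
  have hz : Tendsto (fun θ : ℝ => Complex.exp (-(Complex.I * θ))) (𝓝 0) (𝓝 1) := by
    have : Continuous fun θ : ℝ => Complex.exp (-(Complex.I * θ)) := by fun_prop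
    simpa using this.tendsto 0
  have hq : Tendsto (fun q : ℂ × ℂ × ℂ => charQuot p g q.1 q.2.1 q.2.2)
      (𝓝 ((1 : ℂ), (0 : ℂ), (0 : ℂ))) (𝓝 (charQuot p g 1 0 0)) :=
    (continuous_charQuot p g).tendsto' _ _ rfl
  exact Tendsto.comp (g := fun q : ℂ × ℂ × ℂ => charQuot p g q.1 q.2.1 q.2.2)
    (f := fun θ : ℝ => (Complex.exp (-(Complex.I * θ)), u θ, v θ)) hq
    (hz.prodMk_nhds (hu.prodMk_nhds hv))

/-- The divided difference at two branches tends to a nonzero limit, yet its product with their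
difference is zero. -/
lemma IsPhysical.eventuallyEq (hc : cMinus p < c) {ω ω' : ℝ → ℂ} (hω : IsPhysical χ c ω)
    (hω' : IsPhysical χ c ω') : ω =ᶠ[𝓝 0] ω' := by
  have hg := isCorrection_corrVec χ hc
  filter_upwards [(tendsto_charQuot _ hω.tendsto_half hω'.tendsto_half).eventually_ne
    hg.charQuot_ne_zero] with θ hθ
  have h := charFun_sub p (coordPoly χ (corrVec χ c)) (Complex.exp (-(Complex.I * θ)))
    (Complex.I * ω θ / 2) (Complex.I * ω' θ / 2)
  rw [(hasEigenvalue_vonNeumann_iff χ hc θ _).mp (hω.1 θ),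
    (hasEigenvalue_vonNeumann_iff χ hc θ _).mp (hω'.1 θ), sub_zero] at h
  have h1 := (mul_eq_zero.mp h.symm).resolve_left hθ
  linear_combination (-2 * Complex.I) * h1 + (ω θ - ω' θ) * Complex.I_mul_I

/-- The defect has norm `‖charQuot‖ * errT / 2`, and near `0` the first factor lies between half and
twice its limit. -/
lemma IsPhysical.errT_bounds (hc : cMinus p < c) {ω : ℝ → ℂ} (hω : IsPhysical χ c ω)
    {g : ℝ[X]} (hg : IsCorrection p c g) :
    ∀ᶠ θ in 𝓝 0, ‖charQuot p g 1 0 0‖⁻¹ * ‖defect p g θ‖ ≤ errT ω θ ∧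
      errT ω θ ≤ 4 * ‖charQuot p g 1 0 0‖⁻¹ * ‖defect p g θ‖ := by
  obtain rfl : coordPoly χ (corrVec χ c) = g := (isCorrection_corrVec χ hc).unique hc hg
  set g := coordPoly χ (corrVec χ c)
  have hν : Tendsto (fun θ : ℝ => Complex.I * (θ : ℂ) / 2) (𝓝 0) (𝓝 0) := by
    have : Continuous fun θ : ℝ => Complex.I * (θ : ℂ) / 2 := by fun_prop
    simpa using this.tendsto 0
  have hq : 0 < ‖charQuot p g 1 0 0‖ := norm_pos_iff.mpr hg.charQuot_ne_zero
  have ht := (tendsto_charQuot (p := p) g hω.tendsto_half hν).norm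
  filter_upwards [ht.eventually_lt_const (show _ < 2 * ‖charQuot p g 1 0 0‖ by linarith),
    ht.eventually_const_lt (show ‖charQuot p g 1 0 0‖ / 2 < _ by linarith)] with θ h1 h2
  have h := charFun_sub p g (Complex.exp (-(Complex.I * θ)))
    (Complex.I * ω θ / 2) (Complex.I * θ / 2)
  rw [(hasEigenvalue_vonNeumann_iff χ hc θ _).mp (hω.1 θ), zero_sub] at h
  have h3 := congrArg norm h
  have h4 : ‖Complex.I * ω θ / 2 - Complex.I * θ / 2‖ = errT ω θ / 2 := by
    rw [← sub_div, ← mul_sub, norm_div, norm_mul, Complex.norm_I, errT]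
    simp
  rw [norm_neg, norm_mul, h4] at h3
  change ‖defect p g θ‖ = _ at h3
  have h5 : 0 ≤ errT ω θ := norm_nonneg _
  constructor
  · rw [inv_mul_le_iff₀ hq, h3]
    nlinarith [mul_le_mul_of_nonneg_right h1.le h5]
  · rw [mul_assoc, mul_left_comm, ← div_eq_inv_mul, le_div_iff₀ hq, h3]
    nlinarith [mul_le_mul_of_nonneg_right h2.le h5]

end Physical

/-- The monomial basis. -/
noncomputable def monomialBasis (p : ℕ) : PolyBasis p :=
  degreeLT.basis ℝ (p + 1)

end ESFR

open ESFR in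
theorem theorem3p4 (p : ℕ) (c : ℝ) (hc : ESFR.cMinus p < c) :
    ∃ C₁ : ℝ, 0 < C₁ ∧ ∃ C₂ : ℝ, 0 < C₂ ∧ ∀ χ : ESFR.PolyBasis p,
      (∃ ω : ℝ → ℂ, ESFR.IsPhysical χ c ω) ∧
      (∀ ω ω' : ℝ → ℂ, ESFR.IsPhysical χ c ω → ESFR.IsPhysical χ c ω' → ω =ᶠ[𝓝 0] ω') ∧
      ∀ ω : ℝ → ℂ, ESFR.IsPhysical χ c ω →
        (∃ δ : ℝ, 0 < δ ∧ ∀ θ : ℝ, |θ| < δ →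
          C₁ * ESFR.bigF p c θ ≤ ESFR.errT ω θ ∧ ESFR.errT ω θ ≤ C₂ * ESFR.bigF p c θ) ∧
        (c ≠ 0 → ESFR.errT ω =Θ[𝓝 0] fun θ : ℝ => θ ^ (2 * p + 1)) ∧
        (c = 0 → ESFR.errT ω =Θ[𝓝 0] fun θ : ℝ => θ ^ (2 * p + 2)) := by
  -- The monomial basis serves only to produce `g`, so that the constants are fixed before `χ` is
  -- given.
  have hg := isCorrection_corrVec (monomialBasis p) hc
  set g := coordPoly (monomialBasis p) (corrVec (monomialBasis p) c)
  have hq : 0 < ‖charQuot p g 1 0 0‖ := norm_pos_iff.mpr hg.charQuot_ne_zero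
  have hFS := hg.defect_isTheta.trans (bigF_isTheta p c).symm
  obtain ⟨a, ha, hle⟩ := hFS.1.exists_pos
  obtain ⟨b, hb, hge⟩ := hFS.2.exists_pos
  have hF : ∀ θ, ‖bigF p c θ‖ = bigF p c θ := fun θ => by simp [bigF]
  refine ⟨‖charQuot p g 1 0 0‖⁻¹ * b⁻¹, by positivity,
    4 * ‖charQuot p g 1 0 0‖⁻¹ * a, by positivity, fun χ => ⟨exists_isPhysical hc,
      fun ω ω' h h' => h.eventuallyEq hc h', fun ω hω => ?_⟩⟩
  have hE := hω.errT_bounds hc hg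
  have hbound : ∀ᶠ θ in 𝓝 0, ‖charQuot p g 1 0 0‖⁻¹ * b⁻¹ * bigF p c θ ≤ errT ω θ ∧
      errT ω θ ≤ 4 * ‖charQuot p g 1 0 0‖⁻¹ * a * bigF p c θ := by
    filter_upwards [hE, hle.bound, hge.bound] with θ h1 h2 h3
    rw [hF] at h2 h3
    constructor
    · refine le_trans ?_ h1.1
      rw [mul_assoc]
      gcongr
      rwa [inv_mul_le_iff₀ hb]
    · refine h1.2.trans ?_
      rw [mul_assoc _ a]
      gcongr
  have hT : errT ω =Θ[𝓝 0] fun θ : ℝ => θ ^ errOrder p c := by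
    refine IsTheta.trans ⟨IsBigO.of_bound (4 * ‖charQuot p g 1 0 0‖⁻¹ * a) (hbound.mono fun θ h => ?_),
      IsBigO.of_bound (‖charQuot p g 1 0 0‖⁻¹ * b⁻¹)⁻¹ (hbound.mono fun θ h => ?_)⟩
      (bigF_isTheta p c)
    · rw [hF, errT, norm_norm]
      exact h.2
    · rw [hF, errT, norm_norm, ← div_eq_inv_mul, le_div_iff₀' (by positivity)]
      exact h.1
  refine ⟨?_, fun h0 => by simpa [errOrder, h0] using hT,
    fun h0 => by simpa [errOrder, h0] using hT⟩
  obtain ⟨δ, hδ, h⟩ := Metric.eventually_nhds_iff.mp hbound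
  exact ⟨δ, hδ, fun θ hθ => h (by simpa using hθ)⟩
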